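/- Let $\eta=\log|y|\,d\arg x-\log|x|\,d\arg y$, a real differential $1$-form on $(\mathbb C^*)^2$, where $d\arg z=\operatorname{Im}(dz/z)$. For $P\in\mathbb C[x,y]$ let $C_P=\{(x,y)\in(\mathbb C^*)^2 : P(x,y)=0,\ dP(x,y)\neq 0\}$ be the smooth part of its zero curve in $(\mathbb C^*)^2$. Call $P$ \emph{exact} if $\eta|_{C_P}$ is exact, that is, if there is a function $V\colon C_P\to\mathbb R$ with $dV=\eta|_{C_P}$; any such $V$ is called a \emph{volume function} of $P$. Let $D$ be the Bloch--Wigner dilogarithm, $D(z)=\operatorname{Im}(\mathrm{Li}_2(z))+\arg(1-z)\log|z|$ for $z\in\mathbb C\setminus([1,\infty)\cup\{0\})$, where $\arg$ takes values in $(-\pi,\pi)$ and $\mathrm{Li}_2(z)=-\int_0^z\log(1-u)\,\frac{du}{u}$, extended continuously to $\mathbb C$ by $D(z)=0$ for $z\in[1,\infty)\cup\{0\}$. For $d\ge 1$ put $$P_d(x,y)=\sum_{i,j\ge 0,\ i+j\leq d}x^iy^j .$$ **Theorem.** For every $d\ge 1$ the polynomial $P_d$ is exact. For every $d\ge 2$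 the function $$V(x,y)=\frac{1}{(d+1)(d+2)}\Big[D(y^{d+1})-D(x^{d+1})-D\big((y/x)^{d+1}\big)\Big]+\frac{1}{d+2}\Big[D(x)-D(y)-D(x/y)\Big]$$ is a volume function of $P_d$, i.e. $dV=\eta$ on all of $C_{P_d}$. -/

import Mathlib

open MvPolynomial

/-- The real-linear form `d arg` at the point `z` of `ℂ*`, i.e. `v ↦ Im (v / z)`. It is globally
defined on `ℂ*` although `arg` itself is not. -/
noncomputable def dArg (z : ℂ) : ℂ →L[ℝ] ℝ :=
  Complex.imCLM ∘L ContinuousLinearMap.mul ℝ ℂ z⁻¹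

/-- The real differential `1`-form `η = log|y| d arg x - log|x| d arg y` on `(ℂ*)²`, given as
the map that sends a point `(x, y)` to a real-linear form on `ℂ × ℂ`. -/
noncomputable def etaForm (p : ℂ × ℂ) : ℂ × ℂ →L[ℝ] ℝ :=
  Real.log ‖p.2‖ • (dArg p.1 ∘L ContinuousLinearMap.fst ℝ ℂ ℂ)
    - Real.log ‖p.1‖ • (dArg p.2 ∘L ContinuousLinearMap.snd ℝ ℂ ℂ)

/-- The smooth part `{(x, y) ∈ (ℂ*)² | P(x, y) = 0, dP(x, y) ≠ 0}` of the curve `P = 0`. -/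
def smoothCurve (P : MvPolynomial (Fin 2) ℂ) : Set (ℂ × ℂ) :=
  {p | p.1 ≠ 0 ∧ p.2 ≠ 0 ∧ eval ![p.1, p.2] P = 0 ∧
    (eval ![p.1, p.2] (pderiv 0 P) ≠ 0 ∨ eval ![p.1, p.2] (pderiv 1 P) ≠ 0)}

/-- `V` is a primitive of `η` restricted to the smooth part `C` of the curve `P = 0`, that is,
`dV = η` on `C`. Only the values of `V` on `C` matter. As `C` is an embedded submanifold,
having `η p` as a derivative at `p` *within* `C` means that `V|_C` is differentiable at `p` and
that its differential is the restriction of `η p` to the tangent line of `C` at `p`.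
(As `η` is smooth on `C`, such a function `V|_C` is automatically smooth.) -/
def IsVolumeFunction (P : MvPolynomial (Fin 2) ℂ) (V : ℂ × ℂ → ℝ) : Prop :=
  ∀ p ∈ smoothCurve P, HasFDerivWithinAt V (etaForm p) (smoothCurve P) p

/-- `P` is exact: the form `η` restricted to the smooth part of `P = 0` is exact. -/
def IsExactPolynomial (P : MvPolynomial (Fin 2) ℂ) : Prop :=
  ∃ V : ℂ × ℂ → ℝ, IsVolumeFunction P V

/-- The polynomial `P_d = ∑_{0 ≤ i + j ≤ d} x^i y^j`. -/
noncomputable def polyP (d : ℕ) : MvPolynomial (Fin 2) ℂ :=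
  ∑ ij ∈ (Finset.range (d + 1) ×ˢ Finset.range (d + 1)).filter (fun ij => ij.1 + ij.2 ≤ d),
    X 0 ^ ij.1 * X 1 ^ ij.2

/-- The dilogarithm `Li₂(z) = -∫_0^z log(1 - u) du/u` for `z ∈ ℂ ∖ [1, ∞)`, the integral being
taken along the segment `u = t z`, `0 ≤ t ≤ 1`, on which `du/u = dt/t`. -/
noncomputable def dilog (z : ℂ) : ℂ :=
  -∫ t in (0 : ℝ)..1, Complex.log (1 - t * z) / t

open Classical in
/-- The Bloch-Wigner dilogarithm `D(z) = Im Li₂(z) + arg(1 - z) log|z|` on `ℂ ∖ [1, ∞)`, extended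
by continuity to `[1, ∞)`, where its value is `0`. -/
noncomputable def blochWigner (z : ℂ) : ℝ :=
  if z.im = 0 ∧ 1 ≤ z.re then 0
  else (dilog z).im + Complex.arg (1 - z) * Real.log ‖z‖

/-- The function `V = [D(y^{d+1}) - D(x^{d+1}) - D((y/x)^{d+1})] / ((d+1)(d+2))
+ [D(x) - D(y) - D(x/y)] / (d+2)`. -/
noncomputable def volumeV (d : ℕ) (p : ℂ × ℂ) : ℝ :=
  1 / (((d : ℝ) + 1) * ((d : ℝ) + 2)) *
      (blochWigner (p.2 ^ (d + 1)) - blochWigner (p.1 ^ (d + 1))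
        - blochWigner ((p.2 / p.1) ^ (d + 1)))
    + 1 / ((d : ℝ) + 2) *
      (blochWigner p.1 - blochWigner p.2 - blochWigner (p.1 / p.2))

/-! Write n = d+1, S(z) = 1 + z + ... + z^d and R(z) = D(z) - D(z^n)/n. Since D(1/z) = -D(z), V
equals [R(x) - R(y) - R(x/y)]/(d+2). From dD = log|z| d arg(1-z) - log|1-z| d arg z and 1 - z^n =
(1-z)S(z) one gets dR = log|S| d arg z - log|z| d arg S, also at z = 1, where the singularities of
the two terms cancel.

Let k be the sum of the monomials of degree d. Then (1-y)P = S(x) - y k, and symmetrically in x and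
y, so on the curve S(x) = y k, S(y) = x k and S(x/y) = k/y^d. Where k ≠ 0, substituting these makes
every term with log|k| or d arg k cancel and leaves (d+2)η.

Where k = 0, the numbers x, y, x/y are n-th roots of unity other than 1, so η vanishes there but the
three terms D(z^n) are singular. The expansion D(1+ε) = Im ε (1 - log|ε|) + o(ε)
(`blochWigner_one_add_isLittleO`) replaces the differential: the arguments are 1 + k c_i, the log|k|
terms cancel because c₂ - c₁ + c₃ vanishes at the point, and the finite terms log|c_i| cancel
against the differentials of D(x), D(y), D(x/y). -/

/-! ### The dilogarithm off its cut. -/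

theorem one_sub_mem_slitPlane_iff {z : ℂ} :
    1 - z ∈ Complex.slitPlane ↔ ¬(z.im = 0 ∧ 1 ≤ z.re) := by
  rw [Complex.mem_slitPlane_iff]
  simp only [Complex.sub_re, Complex.one_re, Complex.sub_im, Complex.one_im, sub_pos, ne_eq,
    zero_sub, neg_eq_zero, not_and_or, not_le]
  tauto

theorem one_sub_mul_mem_slitPlane {z : ℂ} (hz : 1 - z ∈ Complex.slitPlane) {t : ℝ}
    (ht : t ∈ Set.Icc (0 : ℝ) 1) : 1 - t * z ∈ Complex.slitPlane := by
  have h := Complex.starConvex_one_slitPlane hz (sub_nonneg.2 ht.2) ht.1 (by ring)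
  convert h using 1
  simp only [Complex.real_smul]
  push_cast
  ring

theorem isOpen_one_sub_slitPlane : IsOpen {z : ℂ | 1 - z ∈ Complex.slitPlane} :=
  Complex.isOpen_slitPlane.preimage (by fun_prop)

theorem intervalIntegrable_dilog_integrand {z : ℂ} (hz : 1 - z ∈ Complex.slitPlane) :
    IntervalIntegrable (fun t : ℝ => Complex.log (1 - t * z) / t) MeasureTheory.volume 0 1 := by
  set U := {z : ℂ | 1 - z ∈ Complex.slitPlane}
  have hd : DifferentiableOn ℂ (fun w : ℂ => Complex.log (1 - w)) U := by
    intro w hw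
    exact ((((hasDerivAt_id w).const_sub 1).clog hw).differentiableAt).differentiableWithinAt
  have hU : U ∈ nhds (0 : ℂ) := isOpen_one_sub_slitPlane.mem_nhds (by simp [Complex.one_mem_slitPlane])
  have hc := ((Complex.differentiableOn_dslope hU).2 hd).continuousOn
  -- The singularity at t = 0 is removable: the integrand is z times a difference quotient of
  -- log(1-w) at 0, which extends continuously.
  have h1 : ContinuousOn (fun t : ℝ => z * dslope (fun w : ℂ => Complex.log (1 - w)) 0 (t * z))
      (Set.uIcc 0 1) := by
    refine continuousOn_const.mul (hc.comp (by fun_prop) ?_)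
    intro t ht
    rw [Set.uIcc_of_le zero_le_one] at ht
    exact one_sub_mul_mem_slitPlane hz ht
  refine h1.intervalIntegrable.congr ?_
  intro t ht
  rw [Set.uIoc_of_le zero_le_one] at ht
  have ht0 : (t : ℂ) ≠ 0 := by exact_mod_cast ht.1.ne'
  by_cases h0 : z = 0
  · simp [h0]
  · simp only
    rw [dslope_of_ne _ (mul_ne_zero ht0 h0), slope_def_field]
    simp only [sub_zero, Complex.log_one]
    field_simp

/-- Differentiation under the integral: the z-derivative of the integrand is -1/(1 - tz), bounded on
a compact neighbourhood, and its t-primitive is log(1 - tz)/z. -/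
theorem hasDerivAt_dilog {z : ℂ} (hz : 1 - z ∈ Complex.slitPlane) (h0 : z ≠ 0) :
    HasDerivAt dilog (-(Complex.log (1 - z) / z)) z := by
  obtain ⟨r, hr, hrU⟩ := Metric.nhds_basis_closedBall.mem_iff.1
    (isOpen_one_sub_slitPlane.mem_nhds hz)
  have hcont : ContinuousOn (fun q : ℝ × ℂ => (1 - (q.1 : ℂ) * q.2)⁻¹)
      (Set.Icc (0 : ℝ) 1 ×ˢ Metric.closedBall z r) := by
    refine ContinuousOn.inv₀ (by fun_prop) ?_
    rintro ⟨t, w⟩ ⟨ht, hw⟩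
    exact Complex.slitPlane_ne_zero (one_sub_mul_mem_slitPlane (hrU hw) ht)
  obtain ⟨M, hM⟩ := (isCompact_Icc.prod (isCompact_closedBall z r)).exists_bound_of_continuousOn
    hcont
  have hcz : ContinuousOn (fun t : ℝ => -(1 - (t : ℂ) * z)⁻¹) (Set.uIcc 0 1) := by
    rw [Set.uIcc_of_le zero_le_one]
    refine (hcont.comp (f := fun t : ℝ => (t, z)) (by fun_prop) ?_).neg
    exact fun t ht => ⟨ht, Metric.mem_closedBall_self hr.le⟩
  have key := intervalIntegral.hasDerivAt_integral_of_dominated_loc_of_deriv_le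
    (𝕜 := ℂ) (μ := MeasureTheory.volume) (a := 0) (b := 1) (bound := fun _ => M) (x₀ := z)
    (F := fun w (t : ℝ) => Complex.log (1 - t * w) / t)
    (F' := fun w (t : ℝ) => -(1 - (t : ℂ) * w)⁻¹)
    (Metric.closedBall_mem_nhds z hr)
    (Filter.Eventually.of_forall fun w => Measurable.aestronglyMeasurable (by fun_prop))
    (intervalIntegrable_dilog_integrand hz)
    (Measurable.aestronglyMeasurable (by fun_prop))
    (Filter.Eventually.of_forall fun t ht w hw => by
      rw [Set.uIoc_of_le zero_le_one] at ht
      rw [norm_neg]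
      exact hM (t, w) ⟨⟨ht.1.le, ht.2⟩, hw⟩)
    (by simp)
    (Filter.Eventually.of_forall fun t ht w hw => by
      rw [Set.uIoc_of_le zero_le_one] at ht
      have ht0 : (t : ℂ) ≠ 0 := by exact_mod_cast ht.1.ne'
      have hs := one_sub_mul_mem_slitPlane (hrU hw) ⟨ht.1.le, ht.2⟩
      have hs0 := Complex.slitPlane_ne_zero hs
      have h := (((((hasDerivAt_id w).const_mul (t : ℂ)).const_sub 1).clog hs).div_const (t : ℂ))
      refine h.congr_deriv ?_
      simp only [id]
      field_simp)
  have hint : ∫ t in (0 : ℝ)..1, -(1 - (t : ℂ) * z)⁻¹ = Complex.log (1 - z) / z := by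
    rw [intervalIntegral.integral_eq_sub_of_hasDerivAt
      (f := fun t : ℝ => Complex.log (1 - t * z) / z) ?_ hcz.intervalIntegrable]
    · simp
    · intro t ht
      rw [Set.uIcc_of_le zero_le_one] at ht
      have hs := one_sub_mul_mem_slitPlane hz ht
      have hs0 := Complex.slitPlane_ne_zero hs
      have h := ((((Complex.ofRealCLM.hasDerivAt (x := t)).mul_const z).const_sub 1).clog_real
        hs).div_const z
      refine h.congr_deriv ?_
      rw [Complex.ofRealCLM_apply, Complex.ofRealCLM_apply, Complex.ofReal_one]
      field_simp
  rw [← hint]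
  exact key.2.neg

theorem dilog_ofReal_im {x : ℝ} (hx : x ≤ 1) : (dilog x).im = 0 := by
  have : ∫ t in (0 : ℝ)..1, Complex.log (1 - t * (x : ℂ)) / t =
      ∫ t in (0 : ℝ)..1, ((Real.log (1 - t * x) / t : ℝ) : ℂ) := by
    refine intervalIntegral.integral_congr fun t ht => ?_
    rw [Set.uIcc_of_le zero_le_one] at ht
    have : 0 ≤ 1 - t * x := by nlinarith [ht.1, ht.2]
    push_cast [Complex.ofReal_log this]
    rfl
  rw [dilog, this, intervalIntegral.integral_ofReal, ← Complex.ofReal_neg, Complex.ofReal_im]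

theorem blochWigner_ofReal (x : ℝ) : blochWigner x = 0 := by
  unfold blochWigner
  split_ifs with h
  · rfl
  · have hx : x < 1 := by simpa using h
    rw [dilog_ofReal_im hx.le, ← Complex.ofReal_one, ← Complex.ofReal_sub,
      Complex.arg_ofReal_of_nonneg (by linarith)]
    simp

theorem blochWigner_of_mem {z : ℂ} (hz : 1 - z ∈ Complex.slitPlane) :
    blochWigner z = (dilog z).im + Complex.arg (1 - z) * Real.log ‖z‖ := by
  rw [blochWigner, if_neg (one_sub_mem_slitPlane_iff.1 hz)]

/-! ### Differential of D and the inversion relation. -/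

/-- The differential `v ↦ Re (v / z)` of `log |z|`. -/
noncomputable def dLogAbs (z : ℂ) : ℂ →L[ℝ] ℝ :=
  Complex.reCLM ∘L ContinuousLinearMap.mul ℝ ℂ z⁻¹

theorem dLogAbs_apply (z v : ℂ) : dLogAbs z v = (z⁻¹ * v).re := rfl

theorem dArg_apply (z v : ℂ) : dArg z v = (z⁻¹ * v).im := rfl

theorem HasDerivAt.hasFDerivAt_real {f : ℂ → ℂ} {f' z : ℂ} (h : HasDerivAt f f' z) :
    HasFDerivAt f (ContinuousLinearMap.mul ℝ ℂ f') z := by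
  refine (h.hasFDerivAt.restrictScalars ℝ).congr_fderiv (ContinuousLinearMap.ext fun v => ?_)
  simp [mul_comm]

theorem hasFDerivAt_log_norm {z : ℂ} (hz : z ≠ 0) :
    HasFDerivAt (fun w : ℂ => Real.log ‖w‖) (dLogAbs z) z := by
  -- Dividing by z moves the base point to 1, away from the cut of the logarithm.
  have h1 : HasDerivAt (fun w : ℂ => Complex.log (w / z)) (z⁻¹) z := by
    have := ((hasDerivAt_id z).div_const z).clog (by simp [hz])
    simpa [hz] using this
  have h2 : HasFDerivAt (fun w : ℂ => (Complex.log (w / z)).re + Real.log ‖z‖) (dLogAbs z) z :=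
    ((Complex.reCLM.hasFDerivAt).comp z h1.hasFDerivAt_real).add_const _
  refine h2.congr_of_eventuallyEq ?_
  filter_upwards [isOpen_ne.mem_nhds hz] with w hw
  have hw' : w ≠ 0 := hw
  rw [Complex.log_re, norm_div, Real.log_div (norm_ne_zero_iff.2 hw') (norm_ne_zero_iff.2 hz)]
  ring

/-- The differential `log|z| d arg(1 - z) - log|1 - z| d arg z` of the Bloch–Wigner dilogarithm. -/
noncomputable def dBlochWigner (z : ℂ) : ℂ →L[ℝ] ℝ :=
  -(Real.log ‖z‖ • dArg (1 - z)) - Real.log ‖1 - z‖ • dArg z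

/-- The first minus sign is d(1-z) = -dz: here `dArg (1 - z)` acts on v rather than on -v. -/
theorem dBlochWigner_apply (z v : ℂ) : dBlochWigner z v =
    -(Real.log ‖z‖ * ((1 - z)⁻¹ * v).im) - Real.log ‖1 - z‖ * (z⁻¹ * v).im := rfl

theorem hasFDerivAt_blochWigner_of_mem {z : ℂ} (hz : 1 - z ∈ Complex.slitPlane) (h0 : z ≠ 0) :
    HasFDerivAt blochWigner (dBlochWigner z) z := by
  have h1 := Complex.imCLM.hasFDerivAt.comp z (hasDerivAt_dilog hz h0).hasFDerivAt_real
  have h2 := Complex.imCLM.hasFDerivAt.comp z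
    (((hasDerivAt_id z).const_sub 1).clog hz).hasFDerivAt_real
  have h3 := h1.add (h2.mul (hasFDerivAt_log_norm h0))
  have h4 := h3.congr_of_eventuallyEq (f₁ := blochWigner) (by
    filter_upwards [isOpen_one_sub_slitPlane.mem_nhds hz] with w hw
    rw [blochWigner_of_mem hw]
    simp [Complex.log_im])
  refine h4.congr_fderiv (ContinuousLinearMap.ext fun v => ?_)
  simp only [dBlochWigner_apply, add_apply, smul_apply,
    ContinuousLinearMap.comp_apply, ContinuousLinearMap.mul_apply', Complex.imCLM_apply,
    smul_eq_mul, dLogAbs_apply, Function.comp, id]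
  have e1 : -(Complex.log (1 - z) / z) * v = -(Complex.log (1 - z) * (z⁻¹ * v)) := by
    rw [div_eq_mul_inv]; ring
  have e2 : -1 / (1 - z) * v = -((1 - z)⁻¹ * v) := by
    rw [div_eq_mul_inv]; ring
  rw [e1, e2]
  simp only [Complex.neg_im, Complex.mul_im (Complex.log _), Complex.log_re]
  ring

theorem dBlochWigner_inv {w : ℂ} (h0 : w ≠ 0) (h1 : w ≠ 1) (v : ℂ) :
    dBlochWigner w⁻¹ (-(w ^ 2)⁻¹ * v) = -dBlochWigner w v := by
  have hw1 : 1 - w ≠ 0 := sub_ne_zero.2 h1.symm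
  have hw2 : w - 1 ≠ 0 := sub_ne_zero.2 h1
  have e3 : 1 - w⁻¹ = -((1 - w) / w) := by field_simp; ring
  have e1 : (1 - w⁻¹)⁻¹ * (-(w ^ 2)⁻¹ * v) = (1 - w)⁻¹ * v + w⁻¹ * v := by
    rw [e3]
    field_simp
    ring
  have e2 : w⁻¹⁻¹ * (-(w ^ 2)⁻¹ * v) = -(w⁻¹ * v) := by field_simp
  rw [dBlochWigner_apply, dBlochWigner_apply, e1, e2, e3, norm_neg, norm_div, norm_inv,
    Real.log_inv, Real.log_div (norm_ne_zero_iff.2 hw1) (norm_ne_zero_iff.2 h0), Complex.add_im,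
    Complex.neg_im]
  ring

/-- On the connected set ℂ ∖ [0,∞), stable under inversion, D(1/w) + D(w) has zero differential and
vanishes at -1. Real arguments are separate, since D is zero there. -/
theorem blochWigner_inv (z : ℂ) : blochWigner z⁻¹ = -blochWigner z := by
  by_cases hz : z.im = 0
  · obtain ⟨x, rfl⟩ : ∃ x : ℝ, (x : ℂ) = z := ⟨z.re, Complex.ext rfl hz.symm⟩
    rw [← Complex.ofReal_inv, blochWigner_ofReal, blochWigner_ofReal, neg_zero]
  set S := {w : ℂ | -w ∈ Complex.slitPlane}
  have hSo : IsOpen S := Complex.isOpen_slitPlane.preimage (by fun_prop)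
  have hSc : IsPreconnected S := by
    have : S = Neg.neg '' Complex.slitPlane := by
      ext w; simp [S]
    rw [this]
    exact (Complex.starConvex_one_slitPlane.isPathConnected
      (by simp)).isConnected.isPreconnected.image _
      (by fun_prop)
  have hS0 : ∀ w ∈ S, w ≠ 0 := by
    rintro w hw rfl; simp [S] at hw
  have hS1 : ∀ w ∈ S, 1 - w ∈ Complex.slitPlane := by
    intro w hw
    simp only [S, Set.mem_ofPred_eq, Complex.mem_slitPlane_iff, Complex.neg_re, Complex.neg_im,
      Complex.sub_re, Complex.sub_im, Complex.one_re, Complex.one_im] at hw ⊢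
    rcases hw with h | h
    · left; linarith
    · right; simpa using h
  have hSinv : ∀ w ∈ S, w⁻¹ ∈ S := by
    intro w hw
    simp only [S, Set.mem_ofPred_eq] at hw ⊢
    rw [← inv_neg]
    rw [Complex.mem_slitPlane_iff_arg] at hw ⊢
    refine ⟨?_, inv_ne_zero hw.2⟩
    rw [Complex.arg_inv, if_neg hw.1]
    intro h
    linarith [Complex.neg_pi_lt_arg (-w), Complex.arg_le_pi (-w)]
  have hder : ∀ w ∈ S, HasFDerivAt (fun w => blochWigner w⁻¹ + blochWigner w)
      (0 : ℂ →L[ℝ] ℝ) w := by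
    intro w hw
    have h0 := hS0 w hw
    have h1 := (hasFDerivAt_blochWigner_of_mem (hS1 _ (hSinv w hw)) (inv_ne_zero h0)).comp w
      (hasDerivAt_inv h0).hasFDerivAt_real
    have h2 := h1.add (hasFDerivAt_blochWigner_of_mem (hS1 _ hw) h0)
    refine h2.congr_fderiv (ContinuousLinearMap.ext fun v => ?_)
    have hw1 : w ≠ 1 := (sub_ne_zero.1 (Complex.slitPlane_ne_zero (hS1 w hw))).symm
    simp only [zero_apply, add_apply, ContinuousLinearMap.comp_apply,
      ContinuousLinearMap.mul_apply', dBlochWigner_inv h0 hw1]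
    ring
  have hzS : z ∈ S := by
    simp only [S, Set.mem_ofPred_eq, Complex.mem_slitPlane_iff, Complex.neg_im]
    right; simpa using hz
  have hm : (-1 : ℂ) ∈ S := by simp [S]
  have h := hSo.is_const_of_fderiv_eq_zero (𝕜 := ℝ) hSc
    (fun w hw => (hder w hw).differentiableAt.differentiableWithinAt)
    (fun w hw => (hder w hw).fderiv) hzS hm
  have hm0 : blochWigner (-1) = 0 := by simpa using blochWigner_ofReal (-1)
  have hm1 : (-1 : ℂ)⁻¹ = -1 := by norm_num
  simp only [hm1, hm0] at h
  linarith

theorem hasFDerivAt_blochWigner {z : ℂ} (h0 : z ≠ 0) (h1 : z ≠ 1) :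
    HasFDerivAt blochWigner (dBlochWigner z) z := by
  by_cases hz : 1 - z ∈ Complex.slitPlane
  · exact hasFDerivAt_blochWigner_of_mem hz h0
  -- On the cut (1,∞), inversion transports the differential from (0,1), where it is known.
  have hz' := hz
  rw [one_sub_mem_slitPlane_iff, not_not] at hz'
  obtain ⟨x, rfl⟩ : ∃ x : ℝ, (x : ℂ) = z := ⟨z.re, Complex.ext rfl hz'.1.symm⟩
  have hx : 1 < x := lt_of_le_of_ne (by simpa using hz'.2) (by rintro rfl; simp at h1)
  have hi : 1 - (x : ℂ)⁻¹ ∈ Complex.slitPlane := by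
    rw [← Complex.ofReal_inv, ← Complex.ofReal_one, ← Complex.ofReal_sub,
      Complex.ofReal_mem_slitPlane, sub_pos]
    exact inv_lt_one_of_one_lt₀ hx
  have h2 := ((hasFDerivAt_blochWigner_of_mem hi (inv_ne_zero h0)).comp _
    (hasDerivAt_inv h0).hasFDerivAt_real).neg
  have h3 := h2.congr_of_eventuallyEq (f₁ := blochWigner)
    (Filter.Eventually.of_forall fun w => by simp [blochWigner_inv])
  refine h3.congr_fderiv (ContinuousLinearMap.ext fun v => ?_)
  simp only [neg_apply, ContinuousLinearMap.comp_apply,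
    ContinuousLinearMap.mul_apply', dBlochWigner_inv h0 h1, neg_neg]

/-! ### Asymptotics of D at its singular point 1. -/

open Filter Topology Asymptotics in
theorem tendsto_norm_mul_abs_log {E : Type*} [NormedAddCommGroup E] :
    Tendsto (fun v : E => ‖v‖ * (1 + |Real.log ‖v‖|)) (𝓝 0) (𝓝 0) := by
  have h : Continuous fun v : E => ‖v‖ + |‖v‖ * Real.log ‖v‖| :=
    continuous_norm.add (Real.continuous_mul_log.comp continuous_norm).abs
  have h0 := h.tendsto 0
  simp only [norm_zero, zero_mul, abs_zero, add_zero] at h0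
  refine h0.congr fun v => ?_
  rw [abs_mul, abs_norm]
  ring

/-- Integrate dD along the circle of radius r = |ε| about 1, starting at the real point 1 + r, where
D is zero. The angular derivative of the difference is O(r²(1 + |log r|)), and the arc has angle at
most π. -/
theorem abs_blochWigner_one_add_sub_le {ε : ℂ} (hε : ‖ε‖ ≤ 1 / 2) :
    |blochWigner (1 + ε) - ε.im * (1 - Real.log ‖ε‖)| ≤
      2 * Real.pi * (‖ε‖ * (1 + |Real.log ‖ε‖|)) * ‖ε‖ := by
  rcases eq_or_ne ε 0 with rfl | h0
  · have := blochWigner_ofReal 1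
    simp_all
  set r := ‖ε‖ with hr
  have hr0 : 0 < r := norm_pos_iff.2 h0
  set e : ℝ → ℂ := fun θ => r * Complex.exp (θ * Complex.I) with he
  have hnorm : ∀ θ, ‖e θ‖ = r := fun θ => by
    simp [he, Complex.norm_exp_ofReal_mul_I, abs_of_pos hr0]
  have hde : ∀ θ : ℝ, HasDerivAt e (e θ * Complex.I) θ := fun θ => by
    refine ((((Complex.ofRealCLM.hasDerivAt (x := θ)).mul_const Complex.I).cexp).const_mul
      (r : ℂ)).congr_deriv ?_
    simp only [he, Complex.ofRealCLM_apply, Complex.ofReal_one]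
    ring
  set g : ℝ → ℝ := fun θ => blochWigner (1 + e θ) - (e θ).im * (1 - Real.log r) with hg
  have hne : ∀ θ, e θ ≠ 0 := fun θ => by rw [← norm_pos_iff, hnorm]; exact hr0
  have hne1 : ∀ θ, 1 + e θ ≠ 0 := fun θ h => by
    have : ‖e θ‖ = 1 := by rw [← neg_eq_of_add_eq_zero_right h]; simp
    rw [hnorm] at this
    linarith
  have hdg : ∀ θ : ℝ, HasDerivAt g
      (((Complex.log (1 + e θ) - e θ).re) + Real.log r * (e θ ^ 2 / (1 + e θ)).re) θ := fun θ => by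
    have h1 := (hasFDerivAt_blochWigner (hne1 θ) (by simpa using hne θ)).comp_hasDerivAt θ
      ((hde θ).const_add 1)
    have h2 := (Complex.imCLM.hasFDerivAt.comp_hasDerivAt θ (hde θ)).mul_const (1 - Real.log r)
    refine (h1.sub h2).congr_deriv ?_
    have a1 : (1 - (1 + e θ))⁻¹ * (e θ * Complex.I) = -Complex.I := by
      have := hne θ
      rw [show 1 - (1 + e θ) = -e θ by ring]
      field_simp
    have a2 : (1 + e θ)⁻¹ * (e θ * Complex.I) = (e θ - e θ ^ 2 / (1 + e θ)) * Complex.I := by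
      have := hne1 θ
      field_simp
      ring
    have a3 : ‖1 - (1 + e θ)‖ = r := by
      rw [show 1 - (1 + e θ) = -e θ by ring, norm_neg, hnorm]
    rw [dBlochWigner_apply, a1, a2, a3]
    simp only [Complex.sub_re, Complex.log_re, Complex.imCLM_apply, Complex.mul_I_im,
      Complex.neg_im, Complex.I_im]
    ring
  have hbd : ∀ θ : ℝ, ‖((Complex.log (1 + e θ) - e θ).re) +
      Real.log r * (e θ ^ 2 / (1 + e θ)).re‖ ≤ 2 * (r * (1 + |Real.log r|)) * r := fun θ => by
    have b0 : 1 / 2 ≤ ‖1 + e θ‖ := by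
      have := norm_sub_norm_le (1 : ℂ) (-e θ)
      rw [norm_neg, hnorm, norm_one, sub_neg_eq_add] at this
      linarith
    have b1 : |(Complex.log (1 + e θ) - e θ).re| ≤ 2 * r ^ 2 := by
      refine (Complex.abs_re_le_norm _).trans
        ((Complex.norm_log_one_add_sub_self_le (by rw [hnorm]; linarith)).trans ?_)
      rw [hnorm]
      have : (1 - r)⁻¹ ≤ 2 := by
        rw [inv_le_comm₀ (by linarith) (by norm_num)]
        linarith
      nlinarith [sq_nonneg r]
    have b2 : |(e θ ^ 2 / (1 + e θ)).re| ≤ 2 * r ^ 2 := by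
      refine (Complex.abs_re_le_norm _).trans ?_
      rw [norm_div, norm_pow, hnorm, div_le_iff₀ (by linarith)]
      nlinarith [sq_nonneg r]
    rw [Real.norm_eq_abs]
    refine (abs_add_le _ _).trans ?_
    rw [abs_mul]
    nlinarith [mul_le_mul_of_nonneg_left b2 (abs_nonneg (Real.log r))]
  have hmv := Convex.norm_image_sub_le_of_norm_hasDerivWithin_le (s := Set.univ) (x := 0)
    (y := Complex.arg ε) (fun θ _ => (hdg θ).hasDerivWithinAt) (fun θ _ => hbd θ) convex_univ
    trivial trivial
  have hg0 : g 0 = 0 := by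
    have := blochWigner_ofReal (1 + r)
    simp only [hg, he, Complex.ofReal_zero, zero_mul, Complex.exp_zero, mul_one,
      Complex.ofReal_im, sub_zero]
    exact_mod_cast this
  have heε : e (Complex.arg ε) = ε := Complex.norm_mul_exp_arg_mul_I ε
  rw [hg0, sub_zero, sub_zero, Real.norm_eq_abs, Real.norm_eq_abs] at hmv
  simp only [hg, heε] at hmv
  refine hmv.trans ?_
  have := mul_le_mul_of_nonneg_left (Complex.abs_arg_le_pi ε)
    (show 0 ≤ 2 * (r * (1 + |Real.log r|)) * r by positivity)
  linarith

open Filter Topology Asymptotics in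
theorem blochWigner_one_add_isLittleO :
    (fun ε : ℂ => blochWigner (1 + ε) - ε.im * (1 - Real.log ‖ε‖)) =o[𝓝 0] fun ε => ε := by
  have h1 : (fun ε : ℂ => blochWigner (1 + ε) - ε.im * (1 - Real.log ‖ε‖)) =O[𝓝 0]
      fun ε => (‖ε‖ * (1 + |Real.log ‖ε‖|)) * ‖ε‖ := by
    refine IsBigO.of_bound (2 * Real.pi) ?_
    filter_upwards [Metric.closedBall_mem_nhds (0 : ℂ) (show (0 : ℝ) < 1 / 2 by norm_num)] with ε hε
    rw [mem_closedBall_zero_iff] at hε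
    refine (abs_blochWigner_one_add_sub_le hε).trans_eq ?_
    rw [Real.norm_of_nonneg (by positivity)]
    ring
  refine h1.trans_isLittleO ?_
  have h2 := ((isLittleO_one_iff ℝ).2 (tendsto_norm_mul_abs_log (E := ℂ))).mul_isBigO
    (isBigO_refl (fun ε : ℂ => ‖ε‖) (𝓝 0))
  simp only [one_mul] at h2
  exact isLittleO_norm_right.1 h2

open Filter Topology Asymptotics in
-- Logarithmic terms become negligible once their coefficient has a second small factor, as |k|
-- log|k| tends to 0. This discards the log|k| terms when leading coefficients cancel.
theorem isLittleO_mul_im_mul_sub_log {α F : Type*} [NormedAddCommGroup F] {l : Filter α}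
    {k h : α → ℂ} {u : α → F} (hk : Tendsto k l (𝓝 0)) (hh : h =O[l] u) (a : ℝ) :
    (fun q => (k q * h q).im * (a - Real.log ‖k q‖)) =o[l] u := by
  have h1 : (fun q => (k q * h q).im * (a - Real.log ‖k q‖)) =O[l]
      fun q => (‖k q‖ * (1 + |Real.log ‖k q‖|)) * ‖h q‖ := by
    refine IsBigO.of_bound (|a| + 1) (Eventually.of_forall fun q => ?_)
    rw [norm_mul, Real.norm_eq_abs, Real.norm_eq_abs, Real.norm_of_nonneg (by positivity)]
    have b1 := (Complex.abs_im_le_norm (k q * h q)).trans_eq (norm_mul _ _)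
    have b2 : |a - Real.log ‖k q‖| ≤ (|a| + 1) * (1 + |Real.log ‖k q‖|) := by
      nlinarith [abs_sub a (Real.log ‖k q‖), abs_nonneg a, abs_nonneg (Real.log ‖k q‖)]
    calc _ ≤ (‖k q‖ * ‖h q‖) * ((|a| + 1) * (1 + |Real.log ‖k q‖|)) :=
          mul_le_mul b1 b2 (abs_nonneg _) (by positivity)
      _ = _ := by ring
  refine h1.trans_isLittleO ?_
  have h2 := ((isLittleO_one_iff ℝ).2 ((tendsto_norm_mul_abs_log (E := ℂ)).comp hk)).mul_isBigO
    hh.norm_norm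
  simp only [one_mul] at h2
  exact isLittleO_norm_right.1 h2

open Filter Topology Asymptotics in
-- Splitting log|kc| = log|k| + log|c| and freezing c at its limit isolates log|k|, so that
-- expansions sharing the factor k can be compared.
theorem blochWigner_one_add_mul_isLittleO {α F : Type*} [NormedAddCommGroup F] {l : Filter α}
    {f k c : α → ℂ} {u : α → F} {c₀ : ℂ} (hu : Tendsto u l (𝓝 0)) (hk : k =O[l] u)
    (hc : Tendsto c l (𝓝 c₀)) (hc₀ : c₀ ≠ 0) (hf : ∀ᶠ q in l, f q = k q * c q) :
    (fun q => blochWigner (1 + f q) - (f q).im * (1 - Real.log ‖c₀‖ - Real.log ‖k q‖))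
      =o[l] u := by
  have hfO : f =O[l] u := by
    have h := hk.norm_right.mul (hc.isBigO_one ℝ)
    have h' : f =O[l] fun q => ‖u q‖ * (1 : ℝ) :=
      (h.congr' (hf.mono fun q hq => hq.symm) EventuallyEq.rfl).trans
        (by simpa using isBigO_refl _ _)
    simpa using h'
  have hf0 : Tendsto f l (𝓝 0) := hfO.trans_tendsto hu
  have h1 := (blochWigner_one_add_isLittleO.comp_tendsto hf0).trans_isBigO hfO
  have h2 : (fun q => (f q).im * (Real.log ‖c₀‖ - Real.log ‖c q‖)) =o[l] u := by
    have ht : Tendsto (fun q => Real.log ‖c₀‖ - Real.log ‖c q‖) l (𝓝 0) := by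
      have := (hc.norm.log (norm_ne_zero_iff.2 hc₀)).const_sub (Real.log ‖c₀‖)
      simpa using this
    have hi : (fun q => (f q).im) =O[l] fun q => ‖u q‖ :=
      (IsBigO.of_norm_le fun q => (Complex.abs_im_le_norm (f q))).trans hfO.norm_norm
    have := hi.mul_isLittleO ((isLittleO_one_iff ℝ).2 ht)
    simp only [mul_one] at this
    exact isLittleO_norm_right.1 this
  refine (h1.add h2).congr' ?_ EventuallyEq.rfl
  filter_upwards [hf, hc.eventually_ne hc₀] with q hq hcq
  simp only [Function.comp]
  by_cases hkq : k q = 0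
  · simp [hq, hkq]
  · have : Real.log ‖f q‖ = Real.log ‖k q‖ + Real.log ‖c q‖ := by
      rw [hq, norm_mul, Real.log_mul (norm_ne_zero_iff.2 hkq) (norm_ne_zero_iff.2 hcq)]
    rw [this]
    ring

/-! ### The combination R and its differential. -/

/-- The combination `D(z) - D(z^n) / n`, whose singularity at `z = 1` cancels. -/
noncomputable def reducedBW (n : ℕ) (z : ℂ) : ℝ :=
  blochWigner z - blochWigner (z ^ n) / n

theorem geomSum_mul_sub_one (z : ℂ) (n : ℕ) :
    (∑ i ∈ Finset.range n, z ^ i) * (z - 1) = z ^ n - 1 := geom_sum_mul z n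

open Filter Topology Asymptotics in
theorem hasFDerivAt_reducedBW_one {n : ℕ} (hn : n ≠ 0) :
    HasFDerivAt (reducedBW n) (Real.log n • Complex.imCLM) 1 := by
  have hn0 : (n : ℂ) ≠ 0 := by exact_mod_cast hn
  have hnr : (n : ℝ) ≠ 0 := by exact_mod_cast hn
  set T : ℂ → ℂ := fun z => ∑ i ∈ Finset.range n, z ^ i with hT
  have hT1 : T 1 = n := by simp [hT]
  have hTd : DifferentiableAt ℂ T 1 := by fun_prop
  have hu : Tendsto (fun w : ℂ => w - 1) (𝓝 1) (𝓝 0) :=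
    (by fun_prop : Continuous fun w : ℂ => w - 1).tendsto' _ _ (by simp)
  have h1 := blochWigner_one_add_mul_isLittleO (f := fun w => w - 1) (c := fun _ => 1) hu
    (isBigO_refl _ _) tendsto_const_nhds one_ne_zero (Eventually.of_forall fun q => by simp)
  have h2 := blochWigner_one_add_mul_isLittleO (f := fun w => w ^ n - 1) (c := T) hu
    (isBigO_refl _ _) hTd.continuousAt.tendsto (by rwa [hT1]) (Eventually.of_forall fun q => by
      rw [mul_comm, geomSum_mul_sub_one])
  -- As T(1) = n, the quantity (w-1) - (w^n-1)/n = (w-1)(1 - T(w)/n) is of second order, so its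
  -- product with log|w-1| is negligible.
  have h3 : (fun w => 1 - T w / n) =O[𝓝 1] fun w : ℂ => w - 1 := by
    have := ((hTd.div_const (n : ℂ)).const_sub 1).isBigO_sub
    simpa [hT1, hn0] using this
  have h4 := isLittleO_mul_im_mul_sub_log hu h3 (1 - Real.log n)
  rw [hasFDerivAt_iff_isLittleO]
  refine ((h1.sub (h2.const_mul_left (n : ℝ)⁻¹)).add h4).congr_left fun w => ?_
  have hb1 : blochWigner 1 = 0 := by simpa using blochWigner_ofReal 1
  have e : ((w - 1) * (1 - T w / n)).im = (w - 1).im - (w ^ n - 1).im / n := by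
    have : (w - 1) * (1 - T w / n) = (w - 1) - (w ^ n - 1) / n := by
      rw [← geomSum_mul_sub_one]; ring
    rw [this, Complex.sub_im, Complex.div_natCast_im]
  simp only [reducedBW, one_pow, hb1, e, hT1, add_sub_cancel, smul_apply, Complex.imCLM_apply,
    smul_eq_mul, norm_one, Real.log_one, Complex.norm_natCast]
  field_simp
  ring

theorem hasFDerivAt_reducedBW {n : ℕ} (hn : n ≠ 0) {z s' : ℂ} (h0 : z ≠ 0)
    (hS : ∑ i ∈ Finset.range n, z ^ i ≠ 0)
    (hs' : HasDerivAt (fun z : ℂ => ∑ i ∈ Finset.range n, z ^ i) s' z) :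
    HasFDerivAt (reducedBW n)
      (Real.log ‖∑ i ∈ Finset.range n, z ^ i‖ • dArg z -
        Real.log ‖z‖ • (dArg (∑ i ∈ Finset.range n, z ^ i) ∘L ContinuousLinearMap.mul ℝ ℂ s')) z := by
  have hnr : (n : ℝ) ≠ 0 := by exact_mod_cast hn
  rcases eq_or_ne z 1 with rfl | h1
  · refine (hasFDerivAt_reducedBW_one hn).congr_fderiv (ContinuousLinearMap.ext fun v => ?_)
    simp [dArg_apply]
  set S := ∑ i ∈ Finset.range n, z ^ i with hSdef
  have hz1 : 1 - z ≠ 0 := sub_ne_zero.2 h1.symm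
  have hfac : 1 - z ^ n = (1 - z) * S := by
    have := geomSum_mul_sub_one z n
    linear_combination this
  have hzn : z ^ n ≠ 1 := fun h => mul_ne_zero hz1 hS (by rw [← hfac, h, sub_self])
  -- Two derivatives of z^n - 1 = S(z)(z-1) are compared.
  have hder : (n : ℂ) * z ^ (n - 1) = S - (1 - z) * s' := by
    have a := (hs'.mul ((hasDerivAt_id z).sub_const 1)).congr_of_eventuallyEq
      (f₁ := fun w => w ^ n - 1) (Filter.Eventually.of_forall fun w =>
        (geomSum_mul_sub_one w n).symm)
    have b := ((hasDerivAt_pow n z).sub_const 1).unique a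
    rw [b]
    simp only [id]
    ring
  have hpow : z ^ n = z ^ (n - 1) * z := (pow_sub_one_mul hn z).symm
  have hd := (hasFDerivAt_blochWigner h0 h1).sub
    ((HasFDerivAt.comp (f := fun w : ℂ => w ^ n) z
      (hasFDerivAt_blochWigner (pow_ne_zero n h0) hzn) (hasDerivAt_pow n z).hasFDerivAt_real).mul_const ((n : ℝ)⁻¹))
  refine (hd.congr_of_eventuallyEq (f₁ := reducedBW n) (Filter.Eventually.of_forall fun w => by
    simp [reducedBW, div_eq_mul_inv])).congr_fderiv (ContinuousLinearMap.ext fun v => ?_)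
  have e1 : (1 - z ^ n)⁻¹ * ((n : ℂ) * z ^ (n - 1) * v) = (1 - z)⁻¹ * v - S⁻¹ * (s' * v) := by
    rw [hder, hfac]
    field_simp
  have e2 : (z ^ n)⁻¹ * ((n : ℂ) * z ^ (n - 1) * v) = ((n : ℝ) : ℂ) * (z⁻¹ * v) := by
    rw [hpow]
    push_cast
    field_simp
  simp only [sub_apply, smul_apply, ContinuousLinearMap.comp_apply, dBlochWigner_apply,
    ContinuousLinearMap.mul_apply', dArg_apply, e1, e2, smul_eq_mul, Complex.sub_im,
    Complex.im_ofReal_mul, norm_pow, Real.log_pow]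
  rw [hfac, norm_mul, Real.log_mul (norm_ne_zero_iff.2 hz1) (norm_ne_zero_iff.2 hS)]
  field_simp
  ring

/-! ### Logarithmic differentials within a set. -/

section LogDerivative

variable {E : Type*} [NormedAddCommGroup E] [NormedSpace ℝ E]

/-- `f` does not vanish at `p` and has the logarithmic differential `df / f = ω` there,
within `s`. -/
def HasLogFDerivWithinAt (f : E → ℂ) (ω : E →L[ℝ] ℂ) (s : Set E) (p : E) : Prop :=
  f p ≠ 0 ∧ HasFDerivWithinAt f (f p • ω) s p

variable {f g : E → ℂ} {ω γ σ : E →L[ℝ] ℂ} {s : Set E} {p : E}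

theorem HasFDerivWithinAt.hasLogFDerivWithinAt {f' : E →L[ℝ] ℂ}
    (hf : HasFDerivWithinAt f f' s p) (h0 : f p ≠ 0) :
    HasLogFDerivWithinAt f ((f p)⁻¹ • f') s p := by
  refine ⟨h0, hf.congr_fderiv ?_⟩
  rw [smul_smul, mul_inv_cancel₀ h0, one_smul]

theorem HasLogFDerivWithinAt.mul (hf : HasLogFDerivWithinAt f ω s p)
    (hg : HasLogFDerivWithinAt g γ s p) :
    HasLogFDerivWithinAt (fun q => f q * g q) (ω + γ) s p := by
  refine ⟨mul_ne_zero hf.1 hg.1, (hf.2.mul hg.2).congr_fderiv ?_⟩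
  refine ContinuousLinearMap.ext fun v => ?_
  simp only [add_apply, smul_apply, smul_eq_mul]
  ring

theorem HasLogFDerivWithinAt.inv (hf : HasLogFDerivWithinAt f ω s p) :
    HasLogFDerivWithinAt (fun q => (f q)⁻¹) (-ω) s p := by
  refine ⟨inv_ne_zero hf.1, ((hasDerivAt_inv hf.1).hasFDerivAt_real.comp_hasFDerivWithinAt p
    hf.2).congr_fderiv ?_⟩
  refine ContinuousLinearMap.ext fun v => ?_
  have := hf.1
  simp only [ContinuousLinearMap.comp_apply, neg_apply, smul_apply, smul_eq_mul,
    ContinuousLinearMap.mul_apply']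
  field_simp

theorem HasLogFDerivWithinAt.div (hf : HasLogFDerivWithinAt f ω s p)
    (hg : HasLogFDerivWithinAt g γ s p) :
    HasLogFDerivWithinAt (fun q => f q / g q) (ω - γ) s p := by
  simpa only [div_eq_mul_inv, sub_eq_add_neg] using hf.mul hg.inv

theorem HasLogFDerivWithinAt.pow (hf : HasLogFDerivWithinAt f ω s p) (n : ℕ) :
    HasLogFDerivWithinAt (fun q => f q ^ n) (n • ω) s p := by
  induction n with
  | zero =>
    simpa [HasLogFDerivWithinAt] using hasFDerivWithinAt_const (1 : ℂ) p s
  | succ n ih => simpa only [pow_succ, add_smul, one_smul] using ih.mul hf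

theorem HasLogFDerivWithinAt.congr (hf : HasLogFDerivWithinAt f ω s p)
    (h : ∀ q ∈ s, g q = f q) (hp : p ∈ s) : HasLogFDerivWithinAt g ω s p := by
  refine ⟨by rw [h p hp]; exact hf.1, ?_⟩
  rw [h p hp]
  exact hf.2.congr h (h p hp)

/-- σ may come from a formula for S(g) valid only on s, hence need not equal the ambient logarithmic
differential. -/
theorem HasLogFDerivWithinAt.reducedBW {n : ℕ} (hn : n ≠ 0)
    (hg : HasLogFDerivWithinAt g γ s p)
    (hS : HasLogFDerivWithinAt (fun q => ∑ i ∈ Finset.range n, g q ^ i) σ s p) :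
    HasFDerivWithinAt (fun q => reducedBW n (g q))
      (Real.log ‖∑ i ∈ Finset.range n, g p ^ i‖ • (Complex.imCLM ∘L γ)
        - Real.log ‖g p‖ • (Complex.imCLM ∘L σ)) s p := by
  have hs' : DifferentiableAt ℂ (fun z : ℂ => ∑ i ∈ Finset.range n, z ^ i) (g p) := by fun_prop
  have h1 := (hasFDerivAt_reducedBW hn hg.1 hS.1 hs'.hasDerivAt).comp_hasFDerivWithinAt p hg.2
  have h2 := hs'.hasDerivAt.hasFDerivAt_real.comp_hasFDerivWithinAt p hg.2
  set M : ℂ →L[ℝ] ℝ := Real.log ‖g p‖ • dArg (∑ i ∈ Finset.range n, g p ^ i)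
  -- Adding and subtracting the same function M(S(g)), differentiated in two ways, trades the
  -- ambient differential for σ without uniqueness of derivatives within s.
  have h3 := (h1.add (M.hasFDerivAt.comp_hasFDerivWithinAt p h2)).sub
    (M.hasFDerivAt.comp_hasFDerivWithinAt p hS.2)
  refine (h3.congr_of_eventuallyEq (Filter.Eventually.of_forall fun q => ?_) ?_).congr_fderiv ?_
  · simp
  · simp
  refine ContinuousLinearMap.ext fun v => ?_
  have a1 := hg.1
  have a2 := hS.1
  simp only [M, sub_apply, add_apply, smul_apply, ContinuousLinearMap.comp_apply, smul_eq_mul,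
    dArg_apply, Complex.imCLM_apply, ContinuousLinearMap.mul_apply']
  rw [inv_mul_cancel_left₀ a1, inv_mul_cancel_left₀ a2]
  ring

theorem HasLogFDerivWithinAt.blochWigner (hg : HasLogFDerivWithinAt g γ s p) (h1 : g p ≠ 1)
    (hn : ‖g p‖ = 1) :
    HasFDerivWithinAt (fun q => blochWigner (g q))
      (-(Real.log ‖1 - g p‖ • (Complex.imCLM ∘L γ))) s p := by
  refine ((hasFDerivAt_blochWigner hg.1 h1).comp_hasFDerivWithinAt p hg.2).congr_fderiv ?_
  refine ContinuousLinearMap.ext fun v => ?_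
  have a1 := hg.1
  simp only [neg_apply, smul_apply, ContinuousLinearMap.comp_apply, smul_eq_mul,
    dBlochWigner_apply, Complex.imCLM_apply, hn, Real.log_one]
  rw [inv_mul_cancel_left₀ a1]
  ring

end LogDerivative

/-! ### Factorisations on the curve. -/

/-- The homogeneous polynomial `∑_{i + j = d} x^i y^j`. -/
noncomputable def homSum (d : ℕ) (q : ℂ × ℂ) : ℂ :=
  ∑ i ∈ Finset.range (d + 1), q.1 ^ i * q.2 ^ (d - i)

theorem homSum_swap (d : ℕ) (q : ℂ × ℂ) : homSum d q.swap = homSum d q := by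
  rw [homSum, ← Finset.sum_range_reflect, homSum]
  refine Finset.sum_congr rfl fun i hi => ?_
  rw [Finset.mem_range] at hi
  rw [Prod.fst_swap, Prod.snd_swap, mul_comm, show d + 1 - 1 - i = d - i by omega,
    show d - (d - i) = i by omega]

theorem eval_polyP (d : ℕ) (q : ℂ × ℂ) :
    eval ![q.1, q.2] (polyP d) = ∑ ij ∈ (Finset.range (d + 1) ×ˢ Finset.range (d + 1)).filter
      (fun ij => ij.1 + ij.2 ≤ d), q.1 ^ ij.1 * q.2 ^ ij.2 := by
  simp [polyP]

theorem eval_polyP_eq_sum (d : ℕ) (q : ℂ × ℂ) :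
    eval ![q.1, q.2] (polyP d) =
      ∑ i ∈ Finset.range (d + 1), q.1 ^ i * ∑ j ∈ Finset.range (d + 1 - i), q.2 ^ j := by
  rw [eval_polyP, Finset.sum_filter, Finset.sum_product]
  refine Finset.sum_congr rfl fun i hi => ?_
  rw [Finset.mul_sum, ← Finset.sum_filter]
  refine Finset.sum_congr ?_ fun _ _ => rfl
  ext j
  simp only [Finset.mem_filter, Finset.mem_range] at hi ⊢
  omega

theorem eval_polyP_swap (d : ℕ) (q : ℂ × ℂ) :
    eval ![q.2, q.1] (polyP d) = eval ![q.1, q.2] (polyP d) := by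
  rw [eval_polyP, show ![q.2, q.1] = ![q.swap.1, q.swap.2] from rfl, eval_polyP]
  refine Finset.sum_equiv (Equiv.prodComm ℕ ℕ) (fun ij => ?_) fun ij _ => ?_
  · simp only [Finset.mem_filter, Finset.mem_product, Finset.mem_range, Equiv.prodComm_apply,
      Prod.fst_swap, Prod.snd_swap]
    omega
  · simp [mul_comm]

/-- Sum by powers of x: (1-y) telescopes the inner sum to 1 - y^(d+1-i), and the subtracted terms
form y k. -/
theorem geomSum_sub_mul_homSum (d : ℕ) (q : ℂ × ℂ) :
    ∑ i ∈ Finset.range (d + 1), q.1 ^ i - q.2 * homSum d q =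
      (1 - q.2) * eval ![q.1, q.2] (polyP d) := by
  rw [eval_polyP_eq_sum, homSum, Finset.mul_sum, Finset.mul_sum, ← Finset.sum_sub_distrib]
  refine Finset.sum_congr rfl fun i hi => ?_
  rw [Finset.mem_range] at hi
  have h := geomSum_mul_sub_one q.2 (d + 1 - i)
  rw [show d + 1 - i = d - i + 1 by omega, pow_succ] at h
  rw [show d + 1 - i = d - i + 1 by omega]
  linear_combination q.1 ^ i * h

theorem geomSum_div (d : ℕ) {q : ℂ × ℂ} (h : q.2 ≠ 0) :
    ∑ i ∈ Finset.range (d + 1), (q.1 / q.2) ^ i = homSum d q / q.2 ^ d := by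
  rw [homSum, Finset.sum_div]
  refine Finset.sum_congr rfl fun i hi => ?_
  rw [Finset.mem_range] at hi
  rw [div_pow, show q.2 ^ d = q.2 ^ (d - i) * q.2 ^ i by rw [← pow_add]; congr 1; omega]
  field_simp

theorem geomSum_fst_eq {d : ℕ} {q : ℂ × ℂ} (hq : q ∈ smoothCurve (polyP d)) :
    ∑ i ∈ Finset.range (d + 1), q.1 ^ i = q.2 * homSum d q := by
  have := geomSum_sub_mul_homSum d q
  rw [hq.2.2.1, mul_zero] at this
  exact sub_eq_zero.1 this

theorem geomSum_snd_eq {d : ℕ} {q : ℂ × ℂ} (hq : q ∈ smoothCurve (polyP d)) :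
    ∑ i ∈ Finset.range (d + 1), q.2 ^ i = q.1 * homSum d q := by
  have := geomSum_sub_mul_homSum d q.swap
  rw [homSum_swap, Prod.fst_swap, Prod.snd_swap, eval_polyP_swap, hq.2.2.1, mul_zero] at this
  exact sub_eq_zero.1 this

theorem differentiableAt_homSum (d : ℕ) (q : ℂ × ℂ) : DifferentiableAt ℝ (homSum d) q := by
  unfold homSum
  fun_prop

theorem volumeV_eq_reducedBW (d : ℕ) (q : ℂ × ℂ) :
    volumeV d q = 1 / ((d : ℝ) + 2) * (reducedBW (d + 1) q.1 - reducedBW (d + 1) q.2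
      - reducedBW (d + 1) (q.1 / q.2)) := by
  have : blochWigner ((q.2 / q.1) ^ (d + 1)) = -blochWigner ((q.1 / q.2) ^ (d + 1)) := by
    rw [← blochWigner_inv, ← inv_pow, inv_div]
  rw [volumeV, this]
  simp only [reducedBW]
  push_cast
  field_simp
  ring

theorem hasLogFDerivWithinAt_fst {s : Set (ℂ × ℂ)} {p : ℂ × ℂ} (h : p.1 ≠ 0) :
    HasLogFDerivWithinAt (fun q : ℂ × ℂ => q.1) (p.1⁻¹ • ContinuousLinearMap.fst ℝ ℂ ℂ) s p :=
  hasFDerivWithinAt_fst.hasLogFDerivWithinAt h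

theorem hasLogFDerivWithinAt_snd {s : Set (ℂ × ℂ)} {p : ℂ × ℂ} (h : p.2 ≠ 0) :
    HasLogFDerivWithinAt (fun q : ℂ × ℂ => q.2) (p.2⁻¹ • ContinuousLinearMap.snd ℝ ℂ ℂ) s p :=
  hasFDerivWithinAt_snd.hasLogFDerivWithinAt h

/-! ### The differential of V on the curve. -/

theorem hasFDerivWithinAt_volumeV_of_homSum_ne_zero {d : ℕ} {p : ℂ × ℂ}
    (hp : p ∈ smoothCurve (polyP d)) (hk : homSum d p ≠ 0) :
    HasFDerivWithinAt (volumeV d) (etaForm p) (smoothCurve (polyP d)) p := by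
  set s := smoothCurve (polyP d)
  have hx := hasLogFDerivWithinAt_fst (s := s) hp.1
  have hy := hasLogFDerivWithinAt_snd (s := s) hp.2.1
  have hK := (differentiableAt_homSum d p).hasFDerivAt.hasFDerivWithinAt.hasLogFDerivWithinAt
    (s := s) hk
  set κ := (homSum d p)⁻¹ • fderiv ℝ (homSum d) p
  have h1 := hx.reducedBW d.succ_ne_zero
    ((hy.mul hK).congr (fun q hq => geomSum_fst_eq hq) hp)
  have h2 := hy.reducedBW d.succ_ne_zero
    ((hx.mul hK).congr (fun q hq => geomSum_snd_eq hq) hp)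
  have h3 := (hx.div hy).reducedBW d.succ_ne_zero
    ((hK.div (hy.pow d)).congr (fun q hq => geomSum_div d hq.2.1) hp)
  have h := ((h1.sub h2).sub h3).const_mul (1 / ((d : ℝ) + 2))
  refine (h.congr_of_eventuallyEq (f₁ := volumeV d) (Filter.Eventually.of_forall fun q =>
    volumeV_eq_reducedBW d q) (volumeV_eq_reducedBW d p)).congr_fderiv ?_
  refine ContinuousLinearMap.ext fun v => ?_
  have n1 := norm_ne_zero_iff.2 hp.1
  have n2 := norm_ne_zero_iff.2 hp.2.1
  have n3 := norm_ne_zero_iff.2 hk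
  rw [Nat.succ_eq_add_one, geomSum_fst_eq hp, geomSum_snd_eq hp, geomSum_div d hp.2.1]
  simp only [etaForm, norm_mul, norm_div, norm_pow, Real.log_mul n2 n3, Real.log_mul n1 n3,
    Real.log_div n3 (pow_ne_zero d n2), Real.log_div n1 n2, Real.log_pow]
  simp only [sub_apply, add_apply, smul_apply, ContinuousLinearMap.comp_apply, smul_eq_mul,
    dArg_apply, Complex.imCLM_apply, Complex.sub_im, Complex.add_im, nsmul_eq_mul,
    ContinuousLinearMap.coe_fst', ContinuousLinearMap.coe_snd', ← Complex.ofReal_natCast,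
    Complex.im_ofReal_mul]
  field_simp
  ring

open Filter Topology Asymptotics in
theorem hasFDerivWithinAt_volumeV_of_homSum_eq_zero {d : ℕ} {p : ℂ × ℂ}
    (hp : p ∈ smoothCurve (polyP d)) (hk : homSum d p = 0) :
    HasFDerivWithinAt (volumeV d) (etaForm p) (smoothCurve (polyP d)) p := by
  set s := smoothCurve (polyP d)
  have hd0 : ((d + 1 : ℕ) : ℂ) ≠ 0 := by exact_mod_cast d.succ_ne_zero
  have root : ∀ z : ℂ, ∑ i ∈ Finset.range (d + 1), z ^ i = 0 → z ^ (d + 1) = 1 ∧ z ≠ 1 := by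
    intro z hz
    refine ⟨?_, ?_⟩
    · have := geomSum_mul_sub_one z (d + 1)
      rw [hz, zero_mul] at this
      exact (sub_eq_zero.1 this.symm)
    · rintro rfl
      exact hd0 (by simpa using hz)
  obtain ⟨hX, hx1⟩ := root p.1 (by rw [geomSum_fst_eq hp, hk, mul_zero])
  obtain ⟨hY, hy1⟩ := root p.2 (by rw [geomSum_snd_eq hp, hk, mul_zero])
  obtain ⟨hW, hw1⟩ := root (p.1 / p.2) (by rw [geomSum_div d hp.2.1, hk, zero_div])
  have hnx := Complex.norm_eq_one_of_pow_eq_one hX d.succ_ne_zero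
  have hny := Complex.norm_eq_one_of_pow_eq_one hY d.succ_ne_zero
  have hnw := Complex.norm_eq_one_of_pow_eq_one hW d.succ_ne_zero
  have hx := hasLogFDerivWithinAt_fst (s := s) hp.1
  have hy := hasLogFDerivWithinAt_snd (s := s) hp.2.1
  have hw := hx.div hy
  set u : ℂ × ℂ → ℂ × ℂ := fun q => q - p
  have hu : Tendsto u (𝓝[s] p) (𝓝 0) :=
    ((by fun_prop : Continuous u).tendsto' p 0 (by simp [u])).mono_left nhdsWithin_le_nhds
  have hkO : homSum d =O[𝓝[s] p] u := by
    have := (differentiableAt_homSum d p).isBigO_sub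
    simp only [hk, sub_zero] at this
    exact this.mono nhdsWithin_le_nhds
  have hs : ∀ᶠ q in 𝓝[s] p, q ∈ s := self_mem_nhdsWithin
  set c₁ : ℂ × ℂ → ℂ := fun q => q.2 * (q.1 - 1)
  set c₂ : ℂ × ℂ → ℂ := fun q => q.1 * (q.2 - 1)
  set c₃ : ℂ × ℂ → ℂ := fun q => (q.1 / q.2 - 1) / q.2 ^ d
  have hc₁ : ContinuousAt c₁ p := by fun_prop
  have hc₂ : ContinuousAt c₂ p := by fun_prop
  have hc₃ : ContinuousAt c₃ p := by
    have h1 := hp.2.1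
    have h2 := pow_ne_zero d hp.2.1
    exact ((continuousAt_fst.div continuousAt_snd h1).sub continuousAt_const).div
      (continuousAt_snd.pow d) h2
  have hc₁0 : c₁ p ≠ 0 := mul_ne_zero hp.2.1 (sub_ne_zero.2 hx1)
  have hc₂0 : c₂ p ≠ 0 := mul_ne_zero hp.1 (sub_ne_zero.2 hy1)
  have hc₃0 : c₃ p ≠ 0 := div_ne_zero (sub_ne_zero.2 hw1) (pow_ne_zero d hp.2.1)
  have hf₁ : ∀ q ∈ s, q.1 ^ (d + 1) - 1 = homSum d q * c₁ q := fun q hq => by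
    rw [← geomSum_mul_sub_one, geomSum_fst_eq hq]; ring
  have hf₂ : ∀ q ∈ s, q.2 ^ (d + 1) - 1 = homSum d q * c₂ q := fun q hq => by
    rw [← geomSum_mul_sub_one, geomSum_snd_eq hq]; ring
  have hf₃ : ∀ q ∈ s, (q.1 / q.2) ^ (d + 1) - 1 = homSum d q * c₃ q := fun q hq => by
    rw [← geomSum_mul_sub_one, geomSum_div d hq.2.1]; ring
  have a₁ := blochWigner_one_add_mul_isLittleO hu hkO (hc₁.tendsto.mono_left nhdsWithin_le_nhds)
    hc₁0 (hs.mono hf₁)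
  have a₂ := blochWigner_one_add_mul_isLittleO hu hkO (hc₂.tendsto.mono_left nhdsWithin_le_nhds)
    hc₂0 (hs.mono hf₂)
  have a₃ := blochWigner_one_add_mul_isLittleO hu hkO (hc₃.tendsto.mono_left nhdsWithin_le_nhds)
    hc₃0 (hs.mono hf₃)
  -- The sum equals (y-x)(1 - y^(-(d+1))), which vanishes at p because y^(d+1) = 1 there.
  have hcsum : (fun q => c₂ q - c₁ q + c₃ q) =O[𝓝[s] p] u := by
    have hdiff : DifferentiableAt ℝ
        (fun q : ℂ × ℂ => (q.2 - q.1) * (1 - (q.2 ^ (d + 1))⁻¹)) p := by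
      have h2 := pow_ne_zero (d + 1) hp.2.1
      fun_prop (disch := exact h2)
    have h := (hdiff.isBigO_sub).mono (nhdsWithin_le_nhds (s := s))
    simp only [hY, inv_one, sub_self, mul_zero, sub_zero] at h
    refine h.congr' (hs.mono fun q hq => ?_) EventuallyEq.rfl
    have h2 := hq.2.1
    simp only [c₁, c₂, c₃]
    field_simp
    ring
  have a₄ := isLittleO_mul_im_mul_sub_log (hkO.trans_tendsto hu) hcsum 1
  have b₁ := Complex.imCLM.hasFDerivAt.comp_hasFDerivWithinAt p ((hx.pow (d + 1)).2.sub_const 1)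
  have b₂ := Complex.imCLM.hasFDerivAt.comp_hasFDerivWithinAt p ((hy.pow (d + 1)).2.sub_const 1)
  have b₃ := Complex.imCLM.hasFDerivAt.comp_hasFDerivWithinAt p ((hw.pow (d + 1)).2.sub_const 1)
  have hsing : HasFDerivWithinAt (fun q : ℂ × ℂ => blochWigner (q.2 ^ (d + 1))
      - blochWigner (q.1 ^ (d + 1)) + blochWigner ((q.1 / q.2) ^ (d + 1)))
      (-(Real.log ‖c₂ p‖ • (Complex.imCLM ∘L ((d + 1) • (p.2⁻¹ • ContinuousLinearMap.snd ℝ ℂ ℂ))))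
        + Real.log ‖c₁ p‖ • (Complex.imCLM ∘L ((d + 1) • (p.1⁻¹ • ContinuousLinearMap.fst ℝ ℂ ℂ)))
        - Real.log ‖c₃ p‖ • (Complex.imCLM ∘L ((d + 1) • (p.1⁻¹ • ContinuousLinearMap.fst ℝ ℂ ℂ
          - p.2⁻¹ • ContinuousLinearMap.snd ℝ ℂ ℂ)))) s p := by
    have hlin := (((b₂.const_mul (Real.log ‖c₂ p‖)).neg.add
      (b₁.const_mul (Real.log ‖c₁ p‖))).sub (b₃.const_mul (Real.log ‖c₃ p‖)))
    rw [hasFDerivWithinAt_iff_isLittleO] at hlin ⊢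
    refine ((((a₂.sub a₁).add a₃).add a₄).add hlin).congr' (hs.mono fun q hq => ?_)
      EventuallyEq.rfl
    have hb1 : blochWigner 1 = 0 := by simpa using blochWigner_ofReal 1
    have e : (homSum d q * (c₂ q - c₁ q + c₃ q)).im = (q.2 ^ (d + 1) - 1).im
        - (q.1 ^ (d + 1) - 1).im + ((q.1 / q.2) ^ (d + 1) - 1).im := by
      rw [hf₁ q hq, hf₂ q hq, hf₃ q hq, mul_add, mul_sub, Complex.add_im, Complex.sub_im]
    beta_reduce
    rw [e]
    simp only [hX, hY, hW, hb1, add_sub_cancel, Function.comp, Pi.add_apply, Pi.sub_apply,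
      Pi.neg_apply, Complex.imCLM_apply, sub_self, Complex.zero_im, one_smul, sub_apply, add_apply,
      neg_apply, smul_apply, smul_eq_mul, ContinuousLinearMap.comp_apply]
    ring
  -- Each argument has modulus 1 at p, so only the term -log|1-z| d arg z survives.
  have hreg := ((hx.blochWigner hx1 hnx).sub (hy.blochWigner hy1 hny)).sub
    (hw.blochWigner hw1 hnw)
  have h := (hsing.const_mul (1 / (((d : ℝ) + 1) * ((d : ℝ) + 2)))).add
    (hreg.const_mul (1 / ((d : ℝ) + 2)))
  have hV : ∀ q, volumeV d q = 1 / (((d : ℝ) + 1) * ((d : ℝ) + 2)) *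
      (blochWigner (q.2 ^ (d + 1)) - blochWigner (q.1 ^ (d + 1))
        + blochWigner ((q.1 / q.2) ^ (d + 1)))
      + 1 / ((d : ℝ) + 2) *
      (blochWigner q.1 - blochWigner q.2 - blochWigner (q.1 / q.2)) := fun q => by
    rw [volumeV, show (q.2 / q.1) ^ (d + 1) = ((q.1 / q.2) ^ (d + 1))⁻¹ by
      rw [← inv_pow, inv_div], blochWigner_inv, sub_neg_eq_add]
  refine (h.congr_of_eventuallyEq (f₁ := volumeV d) (Eventually.of_forall hV) (hV p)).congr_fderiv
    (ContinuousLinearMap.ext fun v => ?_)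
  have hd1 : (d : ℝ) + 1 ≠ 0 := by positivity
  simp only [etaForm, c₁, c₂, c₃, norm_mul, norm_div, norm_pow, hnx, hny, one_mul, one_pow, div_one,
    norm_sub_rev (1 : ℂ), Real.log_one, zero_smul, sub_self]
  simp only [zero_apply, sub_apply, add_apply, neg_apply, smul_apply,
    ContinuousLinearMap.comp_apply, smul_eq_mul, Complex.imCLM_apply, Complex.sub_im,
    nsmul_eq_mul, ContinuousLinearMap.coe_fst', ContinuousLinearMap.coe_snd',
    ← Complex.ofReal_natCast, Complex.im_ofReal_mul]
  push_cast
  field_simp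
  ring

theorem isVolumeFunction_volumeV (d : ℕ) : IsVolumeFunction (polyP d) (volumeV d) := fun p hp => by
  by_cases hk : homSum d p = 0
  · exact hasFDerivWithinAt_volumeV_of_homSum_eq_zero hp hk
  · exact hasFDerivWithinAt_volumeV_of_homSum_ne_zero hp hk

theorem mainTheorem3 :
    (∀ d : ℕ, 1 ≤ d → IsExactPolynomial (polyP d)) ∧
      (∀ d : ℕ, 2 ≤ d → IsVolumeFunction (polyP d) (volumeV d)) :=
  ⟨fun d _ => ⟨volumeV d, isVolumeFunction_volumeV d⟩, fun d _ => isVolumeFunction_volumeV d⟩
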